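/- For a finite simple graph $G$ and an Abelian group $\mathcal{G}$, a labeling $f:E(G)\to\mathcal{G}$ is called $\mathcal{G}$-irregular if the weighted degrees $w(v)=\sum_{u\in N(v)}f(uv)$, $v\in V(G)$, are pairwise distinct. The group irregularity strength $s_g(G)$ is the smallest positive integer $s$ such that for every Abelian group $\mathcal{G}$ of order $s$ there exists a $\mathcal{G}$-irregular labeling of $G$. The lexicographic product $H\circ F$ of graphs $H$ and $F$ has vertex set $V(H)\times V(F)$, and $(u,v)$ and $(x,y)$ are adjacent in it if and only if either $u$ is adjacent to $x$ in $H$, or $u=x$ and $v$ is adjacent to $y$ in $F$. $\overline{K}_m$ denotes the graph with $m$ vertices and no edges. **Observation.** Let $H$ be a finite simple graph of order $n\ge 1$ with no isolated vertices and such that every bipartite connected component of $H$ has both color classes of even order. If $G\cong H\circ\overline{K}_{2r+1}$ for some integer $r\geq 2$, then $$s_g(G)=\begin{cases}(2r+1)n,&\text{if } n\not\equiv 2 \pmod 4,\\ (2r+1)n+1,&\text{if } n\equiv 2 \pmod 4.\end{cases}$$ -/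

import Mathlib

namespace SimpleGraph

/-- The weighted degree of `v` under the edge labeling `f : E(G) → A`: the sum of the labels
`f (uv)` over all the neighbors `u` of `v`. -/
noncomputable def weightedDegree {V : Type*} [Fintype V] (G : SimpleGraph V)
    {A : Type*} [AddCommGroup A] (f : G.edgeSet → A) (v : V) : A :=
  open Classical in ∑ u : G.neighborSet v, f ⟨s(v, u), u.property⟩

/-- An edge labeling `f : E(G) → A` is `A`-irregular if all the weighted degrees are distinct. -/
def IsIrregularLabeling {V : Type*} [Fintype V] (G : SimpleGraph V)
    {A : Type*} [AddCommGroup A] (f : G.edgeSet → A) : Prop :=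
  Function.Injective (G.weightedDegree f)

/-- `s` is the group irregularity strength of `G`: the smallest positive integer `s` such that
for every Abelian group `A` of order `s` there is an `A`-irregular labeling of `G`.
(There is no group of order `0`, so positivity has to be required. Every finite group has an
isomorphic copy in `Type`.) -/
def IsGroupIrregularityStrength {V : Type*} [Fintype V] (G : SimpleGraph V) (s : ℕ) : Prop :=
  IsLeast {t : ℕ | 0 < t ∧ ∀ (A : Type) [AddCommGroup A], Nat.card A = t →
    ∃ f : G.edgeSet → A, G.IsIrregularLabeling f} s

/-- The lexicographic product `G ∘ H`: `(u, v)` and `(x, y)` are adjacent iff `u` is adjacent to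
`x` in `G`, or `u = x` and `v` is adjacent to `y` in `H`. -/
def lexProduct {V W : Type*} (G : SimpleGraph V) (H : SimpleGraph W) : SimpleGraph (V × W) where
  Adj p q := G.Adj p.1 q.1 ∨ (p.1 = q.1 ∧ H.Adj p.2 q.2)
  symm := ⟨fun _ _ h => h.imp (fun h => h.symm) (fun h => ⟨h.1.symm, h.2.symm⟩)⟩
  loopless := ⟨fun _ h => h.elim (fun h => h.ne rfl) (fun h => h.2.ne rfl)⟩

/-- All the bipartite components of `G` have both color classes of even order: each class of
each proper `2`-coloring of a component is even. (A component that is not bipartite has no proper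
`2`-coloring; one that is bipartite has exactly two, which differ by exchanging the colors.) -/
def BipartiteComponentsEven {V : Type*} (G : SimpleGraph V) : Prop :=
  ∀ (c : G.ConnectedComponent) (C : c.toSimpleGraph.Coloring (Fin 2)) (i : Fin 2),
    Even (Nat.card (C.colorClass i))

end SimpleGraph

/-! Write m = 2r+1 and L for the product of H with m independent vertices. In an Abelian group A,
the weight functions realized on L by edge labelings form the subgroup generated by the functions
taking a value a at both ends of an edge and 0 elsewhere. Alternating along walks moves any weight
to a chosen root of its component, up to sign. Hence a weight function is realizable as soon as, on
each component of H, either the component is not bipartite and the total weight is a double, or the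
two color classes carry equal sums (`mem_range_weightedDegreeHom`).

What remains is additive: distinct group elements must be distributed among the classes of bipartite
components and the whole non-bipartite components, each part of size k in H receiving mk elements,
with these conditions on the sums. Pairs {x, -x} sum to zero, so they fill up even sizes for free.
The work lies in parts of odd size and in the elements with 2x = 0. If |A| is odd, every element is
a double and bipartite classes, being even, are filled with pairs (`exists_allocation_of_odd`). If 4
divides n and |A| = mn, all elements are used: odd parts are started with blocks of one or three
elements whose sum is a double, and involutions are grouped into zero-sum quadruples, or handled by
hand if there is only one (`exists_allocation_of_four_dvd`).

The lower bound mn is counting. If n is 2 modulo 4, the order mn fails for the cyclic group: the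
weights would be all its elements, whose sum is not a double, while the sum of all weighted degrees
always is (`not_irregularLabeling_zmod`). The next order mn + 1 is odd. -/

/-! ### Allocations of group elements to parts with prescribed sizes and sums. -/

/-- `R` can be split among the parts `p : P` so that `p` receives `s p` elements, of sum `σ p`. -/
def IsAllocation {A P : Type*} [AddCommGroup A] [DecidableEq P]
    (R : Finset A) (s : P → ℕ) (σ : P → A) : Prop :=
  ∃ φ : A → P, ∀ p, (R.filter (φ · = p)).card = s p ∧ ∑ x ∈ R with φ x = p, x = σ p

namespace IsAllocation

variable {A P : Type*} [AddCommGroup A] [DecidableEq P]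

theorem empty [Nonempty P] : IsAllocation (∅ : Finset A) (0 : P → ℕ) 0 :=
  ⟨fun _ => Classical.arbitrary P, by simp⟩

theorem single (B : Finset A) (p : P) :
    IsAllocation B (Pi.single p B.card) (Pi.single p (∑ x ∈ B, x)) := by
  refine ⟨fun _ => p, fun q => ?_⟩
  by_cases h : p = q
  · subst h; simp
  · simp [h]

theorem union [DecidableEq A] {R R' : Finset A} {s s' : P → ℕ} {σ σ' : P → A} (h : IsAllocation R s σ)
    (h' : IsAllocation R' s' σ') (hd : Disjoint R R') :
    IsAllocation (R ∪ R') (s + s') (σ + σ') := by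
  obtain ⟨φ, hφ⟩ := h
  obtain ⟨ψ, hψ⟩ := h'
  refine ⟨fun x => if x ∈ R then φ x else ψ x, fun p => ?_⟩
  have h1 : R.filter (fun x => (if x ∈ R then φ x else ψ x) = p) = R.filter (φ · = p) :=
    Finset.filter_congr fun x hx => by simp [hx]
  have h2 : R'.filter (fun x => (if x ∈ R then φ x else ψ x) = p) = R'.filter (ψ · = p) :=
    Finset.filter_congr fun x hx => by simp [Finset.disjoint_right.1 hd hx]
  have hd' : Disjoint (R.filter (φ · = p)) (R'.filter (ψ · = p)) :=
    Finset.disjoint_filter_filter hd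
  rw [Finset.filter_union, h1, h2, Finset.card_union_of_disjoint hd', Finset.sum_union hd',
    (hφ p).1, (hφ p).2, (hψ p).1, (hψ p).2]
  exact ⟨rfl, rfl⟩

theorem card_eq [Fintype P] {R : Finset A} {s : P → ℕ} {σ : P → A} (h : IsAllocation R s σ) :
    R.card = ∑ p, s p := by
  obtain ⟨φ, hφ⟩ := h
  rw [Finset.card_eq_sum_card_fiberwise (f := φ) (t := Finset.univ) (by simp)]
  exact Finset.sum_congr rfl fun p _ => (hφ p).1

theorem sum_sub_single [Fintype P] (s : P → ℕ) {p : P} {k : ℕ} (hp : k ≤ s p) :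
    ∑ q, (s - Pi.single p k : P → ℕ) q + k = ∑ q, s q := by
  have hle : Pi.single p k ≤ s := by
    intro q
    by_cases hq : q = p
    · subst hq; simpa using hp
    · simp [Pi.single_eq_of_ne hq]
  conv_rhs => rw [← add_tsub_cancel_of_le hle]
  simp [Finset.sum_add_distrib, add_comm]

/-- Every set of the right size has an allocation. -/
theorem exists_of_card [DecidableEq A] [Fintype P] [Nonempty P] (s : P → ℕ) (R : Finset A)
    (h : R.card = ∑ p, s p) : ∃ σ : P → A, IsAllocation R s σ := by
  induction hk : R.card generalizing R s with
  | zero =>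
    have hs : s = 0 := by
      funext p
      have : ∑ p, s p = 0 := by omega
      exact Finset.sum_eq_zero_iff.1 this p (Finset.mem_univ p)
    rw [Finset.card_eq_zero.1 hk, hs]
    exact ⟨0, empty⟩
  | succ k ih =>
    obtain ⟨x, hx⟩ := Finset.card_pos.1 (by omega : 0 < R.card)
    obtain ⟨p, -, hp⟩ : ∃ p ∈ Finset.univ, s p ≠ 0 := by
      by_contra! hc
      have := Finset.sum_eq_zero hc
      omega
    have hle : Pi.single p 1 ≤ s := by
      intro q
      by_cases hq : q = p
      · subst hq; simp; omega
      · simp [Pi.single_eq_of_ne hq]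
    have hs : Pi.single p 1 + (s - Pi.single p 1) = s := add_tsub_cancel_of_le hle
    have hsum : ∑ q, (s - Pi.single p 1 : P → ℕ) q + 1 = ∑ q, s q :=
      sum_sub_single s (by omega)
    have hcard := Finset.card_erase_of_mem hx
    obtain ⟨σ, hσ⟩ := ih (s - Pi.single p 1) (R.erase x) (by omega) (by omega)
    have := (single {x} p).union hσ (by simp)
    rw [Finset.singleton_union, Finset.insert_erase hx, Finset.card_singleton, hs] at this
    exact ⟨_, this⟩

/-- Adding a zero-sum block to one part. -/
theorem add_block [DecidableEq A] {R B : Finset A} {s : P → ℕ} {σ : P → A} {p : P}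
    (h : IsAllocation R (s - Pi.single p B.card) σ)
    (hB : ∑ x ∈ B, x = 0) (hd : Disjoint B R) (hp : B.card ≤ s p) :
    IsAllocation (B ∪ R) s σ := by
  have hle : Pi.single p B.card ≤ s := by
    intro q
    by_cases hq : q = p
    · subst hq; simpa using hp
    · simp [Pi.single_eq_of_ne hq]
  have := (single B p).union h hd
  rwa [add_tsub_cancel_of_le hle, hB, Pi.single_zero, zero_add] at this

end IsAllocation

/-! ### Zero-sum pairs and quadruples. -/

namespace IsAllocation

variable {A P : Type*} [AddCommGroup A] [DecidableEq A] [DecidableEq P]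

/-- A symmetric set without elements of order at most two is a union of zero-sum pairs. -/
theorem of_symm [Fintype P] [Nonempty P] (s : P → ℕ) (hs : ∀ p, Even (s p)) (T : Finset A)
    (hneg : ∀ x ∈ T, -x ∈ T) (hinv : ∀ x ∈ T, x + x ≠ 0) (h : T.card = ∑ p, s p) :
    IsAllocation T s 0 := by
  induction hk : T.card using Nat.strong_induction_on generalizing T s with
  | _ k ih =>
    rcases T.eq_empty_or_nonempty with rfl | ⟨x, hx⟩
    · have hs0 : s = 0 := by
        funext p
        exact Finset.sum_eq_zero_iff.1 h.symm p (Finset.mem_univ p)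
      rw [hs0]
      exact empty
    · have hne : x ≠ -x := fun hxx => hinv x hx (by nth_rewrite 2 [hxx]; simp)
      have hB : ({x, -x} : Finset A).card = 2 := Finset.card_pair hne
      have hsub : ({x, -x} : Finset A) ⊆ T := by
        intro y hy
        rcases Finset.mem_insert.1 hy with rfl | hy
        · exact hx
        · rw [Finset.mem_singleton.1 hy]; exact hneg x hx
      obtain ⟨p, -, hp⟩ : ∃ p ∈ Finset.univ, s p ≠ 0 := by
        by_contra! hc
        have := Finset.sum_eq_zero hc
        have := Finset.card_pos.2 ⟨x, hx⟩
        omega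
      have hp2 : 2 ≤ s p := by
        obtain ⟨d, hd⟩ := hs p
        omega
      have hcard := Finset.card_sdiff_add_card_eq_card hsub
      have hsum := sum_sub_single s hp2
      rw [← Finset.union_sdiff_of_subset hsub]
      have : IsAllocation (T \ {x, -x}) (s - Pi.single p 2) 0 := by
        refine ih _ ?_ _ ?_ _ ?_ ?_ ?_ rfl
        · omega
        · intro q
          by_cases hq : q = p
          · subst hq
            simpa using (Nat.even_sub hp2).2 (by simp [hs q])
          · simpa [Pi.single_eq_of_ne hq] using hs q
        · intro y hy
          simp only [Finset.mem_sdiff, Finset.mem_insert, Finset.mem_singleton, not_or] at hy ⊢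
          refine ⟨hneg y hy.1, fun h => hy.2.2 (by rw [← h, neg_neg]), fun h => hy.2.1 ?_⟩
          exact neg_injective h
        · exact fun y hy => hinv y (Finset.sdiff_subset hy)
        · omega
      exact add_block (p := p) (by rwa [hB]) (by rw [Finset.sum_pair hne]; simp)
        Finset.disjoint_sdiff (by omega)

/-- A set of elements of order at most two that is stable under translation by two different
involutions is a union of zero-sum quadruples. -/
theorem of_translate [Fintype P] [Nonempty P] (s : P → ℕ) {a b : A} (ha : a ≠ 0) (hb : b ≠ 0)
    (hab : a ≠ b) (ha2 : a + a = 0) (hb2 : b + b = 0) (Z : Finset A)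
    (hZ : ∀ x ∈ Z, x + x = 0) (hZa : ∀ x ∈ Z, x + a ∈ Z) (hZb : ∀ x ∈ Z, x + b ∈ Z)
    (h : Z.card ≤ 4 * ∑ p, s p / 4) :
    ∃ s' ≤ s, (∀ p, Even (s' p)) ∧ IsAllocation Z s' 0 := by
  induction hk : Z.card using Nat.strong_induction_on generalizing Z s with
  | _ k ih =>
    rcases Z.eq_empty_or_nonempty with rfl | ⟨x, hx⟩
    · exact ⟨0, fun p => Nat.zero_le _, by simp, empty⟩
    -- A coset of the Klein group {0, a, b, a + b}; its sum is 4x + 2a + 2b = 0.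
    · set B : Finset A := {x, x + a, x + b, x + a + b} with hBdef
      have hab0 : a + b ≠ 0 := fun h => hab (by
        rw [← add_left_inj b, h, hb2])
      have hB : B.card = 4 := by
        rw [hBdef, Finset.card_insert_of_notMem, Finset.card_insert_of_notMem,
          Finset.card_pair]
        · simpa using ha
        · simp [hab, add_assoc, hb]
        · simp [ha, hb, add_assoc, hab0]
      have hx2 := hZ x hx
      have hsumB : ∑ y ∈ B, y = 0 := by
        rw [hBdef, Finset.sum_insert, Finset.sum_insert, Finset.sum_pair]
        · calc _ = (x + x) + (x + x) + (a + a) + (b + b) := by abel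
            _ = 0 := by simp [hx2, ha2, hb2]
        · simpa using ha
        · simp [hab, add_assoc, hb]
        · simp [ha, hb, add_assoc, hab0]
      have hsub : B ⊆ Z := by
        intro y hy
        simp only [hBdef, Finset.mem_insert, Finset.mem_singleton] at hy
        rcases hy with rfl | rfl | rfl | rfl
        exacts [hx, hZa x hx, hZb x hx, hZb _ (hZa x hx)]
      have hBa : ∀ y, y + a ∈ B → y ∈ B := by
        intro y hy
        have hy' : y = y + a + a := by rw [add_assoc, ha2, add_zero]
        simp only [hBdef, Finset.mem_insert, Finset.mem_singleton] at hy
        rcases hy with hy | hy | hy | hy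
        · rw [hy', hy]; simp [hBdef]
        · rw [hy', hy, add_assoc, ha2]; simp [hBdef]
        · rw [hy', hy, add_right_comm]; simp [hBdef]
        · rw [hy', hy, add_right_comm, add_assoc x, ha2]; simp [hBdef]
      have hBb : ∀ y, y + b ∈ B → y ∈ B := by
        intro y hy
        have hy' : y = y + b + b := by rw [add_assoc, hb2, add_zero]
        simp only [hBdef, Finset.mem_insert, Finset.mem_singleton] at hy
        rcases hy with hy | hy | hy | hy
        · rw [hy', hy]; simp [hBdef]
        · rw [hy', hy]; simp [hBdef]
        · rw [hy', hy, add_assoc, hb2]; simp [hBdef]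
        · rw [hy', hy, add_assoc, hb2]; simp [hBdef]
      have hcard := Finset.card_sdiff_add_card_eq_card hsub
      obtain ⟨p, -, hp⟩ : ∃ p ∈ Finset.univ, s p / 4 ≠ 0 := by
        by_contra! hc
        have := Finset.sum_eq_zero hc
        omega
      have hp4 : 4 ≤ s p := by omega
      have hdiv : ∑ q, (s - Pi.single p 4 : P → ℕ) q / 4 + 1 = ∑ q, s q / 4 := by
        rw [← sum_sub_single (fun q => s q / 4) (p := p) (k := 1) (by omega)]
        congr 1
        refine Finset.sum_congr rfl fun q _ => ?_
        by_cases hq : q = p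
        · subst hq; simp; omega
        · simp [Pi.single_eq_of_ne hq]
      obtain ⟨s', hs', heven, hall⟩ := ih (Z \ B).card (by omega) (s - Pi.single p 4) (Z \ B)
        (fun y hy => hZ y (Finset.sdiff_subset hy))
        (fun y hy => Finset.mem_sdiff.2 ⟨hZa y (Finset.mem_sdiff.1 hy).1,
          fun h => (Finset.mem_sdiff.1 hy).2 (hBa y h)⟩)
        (fun y hy => Finset.mem_sdiff.2 ⟨hZb y (Finset.mem_sdiff.1 hy).1,
          fun h => (Finset.mem_sdiff.1 hy).2 (hBb y h)⟩) (by omega) rfl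
      refine ⟨s' + Pi.single p 4, ?_, ?_, ?_⟩
      · intro q
        have := hs' q
        by_cases hq : q = p
        · subst hq; simp at this ⊢; omega
        · simpa [Pi.single_eq_of_ne hq] using this
      · intro q
        by_cases hq : q = p
        · subst hq; simpa using (heven q).add (by decide : Even 4)
        · simpa [Pi.single_eq_of_ne hq] using heven q
      · rw [← Finset.union_sdiff_of_subset hsub]
        refine add_block (p := p) ?_ hsumB Finset.disjoint_sdiff (by simp [hB])
        simpa [hB] using hall

end IsAllocation

/-! ### Blocks for the parts of odd size, and extension to the whole group. -/

section Allocation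

variable {A P : Type*} [AddCommGroup A] [DecidableEq A]

/-- A set `T` without elements of order at most two that holds more than half of the group contains a set
of one or three elements, disjoint from its negative, whose sum is a double. -/
theorem exists_odd_block [Fintype A] (T : Finset A)
    (hinv : ∀ x ∈ T, x + x ≠ 0) (hT : Fintype.card A < 2 * T.card) :
    ∃ B ⊆ T, (B.card = 1 ∨ B.card = 3) ∧ (∀ x ∈ B, -x ∉ B) ∧ ∃ d, ∑ x ∈ B, x = d + d := by
  have hself : ∀ x ∈ T, x ≠ -x := fun x hx h => hinv x hx (by nth_rewrite 2 [h]; simp)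
  by_cases hdouble : ∃ a ∈ T, ∃ d, a = d + d
  · obtain ⟨a, ha, d, hd⟩ := hdouble
    refine ⟨{a}, by simpa using ha, Or.inl (by simp), ?_, d, by simpa using hd⟩
    intro x hx h
    rw [Finset.mem_singleton] at hx h
    exact hself a ha (by rw [hx] at h; exact h.symm)
  -- With no double in T, a zero-sum triple is sought instead: T and -a - T each hold more than half
  -- of the group, so they meet.
  · push Not at hdouble
    obtain ⟨a, ha⟩ := Finset.card_pos.1 (by omega : 0 < T.card)
    have himg : (T.image fun x => -a - x).card = T.card :=
      Finset.card_image_of_injective _ fun x y h => by simpa using h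
    obtain ⟨b, hb⟩ : (T ∩ T.image fun x => -a - x).Nonempty := by
      rw [← Finset.card_pos]
      have h1 := Finset.card_union_add_card_inter T (T.image fun x => -a - x)
      have h2 := Finset.card_le_univ (T ∪ T.image fun x => -a - x)
      omega
    obtain ⟨hbT, c, hc, hbc⟩ : b ∈ T ∧ ∃ c ∈ T, -a - c = b := by simpa using hb
    have hsum : a + b + c = 0 := by rw [← hbc]; abel
    -- If x = y, then z = -x - x would be a double; if x = -y, then z = 0.
    have key : ∀ x ∈ T, ∀ y ∈ T, ∀ z ∈ T, x + y + z = 0 → x ≠ y ∧ x ≠ -y := by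
      intro x hx y hy z hz h
      refine ⟨fun hxy => hdouble z hz (-x) ?_, fun hxy => hinv z hz ?_⟩
      · rw [← hxy] at h
        rw [eq_neg_of_add_eq_zero_right h, neg_add]
      · rw [hxy, neg_add_cancel, zero_add] at h
        rw [h, add_zero]
    obtain ⟨hab, hab'⟩ := key a ha b hbT c hc hsum
    obtain ⟨hac, hac'⟩ := key a ha c hc b hbT (by rw [← hsum]; abel)
    obtain ⟨hcb, hcb'⟩ := key b hbT c hc a ha (by rw [← hsum]; abel)
    refine ⟨{a, b, c}, ?_, Or.inr (Finset.card_eq_three.2 ⟨a, b, c, hab, hac, hcb, rfl⟩), ?_,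
      0, ?_⟩
    · intro x hx
      simp only [Finset.mem_insert, Finset.mem_singleton] at hx
      rcases hx with rfl | rfl | rfl <;> assumption
    · intro x hx h
      simp only [Finset.mem_insert, Finset.mem_singleton] at hx h
      have ha' := hself a ha
      have hb' := hself b hbT
      have hc' := hself c hc
      rcases hx with rfl | rfl | rfl <;> rcases h with h | h | h
      all_goals first
        | exact ha' h.symm | exact hb' h.symm | exact hc' h.symm
        | exact hab' h.symm | exact hac' h.symm | exact hcb' h.symm
        | exact hab' (neg_eq_iff_eq_neg.1 h) | exact hac' (neg_eq_iff_eq_neg.1 h)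
        | exact hcb' (neg_eq_iff_eq_neg.1 h)
    · rw [Finset.sum_insert (by simp [hab, hac]), Finset.sum_pair hcb, ← add_assoc, hsum, add_zero]

/-- The odd parts are treated two at a time: one receives a block B from `exists_odd_block`, the
other receives -B. The set used up thus stays symmetric, so what is left can later be split into
pairs. The two numerical bounds keep enough elements available at every stage. -/
theorem exists_odd_allocation [DecidableEq P] [Nonempty P] [Fintype A]
    (h2 : 5 * (Finset.univ.filter fun x : A => x + x = 0).card ≤ Fintype.card A) (k : ℕ)
    (O : Finset P) (hO : O.card = 2 * k) (h15 : 15 * O.card ≤ Fintype.card A) :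
    ∃ (U : Finset A) (s : P → ℕ) (σ : P → A), IsAllocation U s σ ∧ (∀ x ∈ U, -x ∈ U) ∧
      (∀ x ∈ U, x + x ≠ 0) ∧ U.card ≤ 3 * O.card ∧ (∀ p ∈ O, s p = 1 ∨ s p = 3) ∧
      (∀ p ∉ O, s p = 0 ∧ σ p = 0) ∧ ∀ p, ∃ d, σ p = d + d := by
  induction k generalizing O with
  | zero =>
    have : O = ∅ := by rw [← Finset.card_eq_zero]; omega
    subst this
    exact ⟨∅, 0, 0, .empty, by simp, by simp, by simp, by simp, by simp, fun p => ⟨0, by simp⟩⟩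
  | succ k ih =>
    obtain ⟨p, hp⟩ := Finset.card_pos.1 (by omega : 0 < O.card)
    have hc1 := Finset.card_erase_of_mem hp
    obtain ⟨q, hq⟩ := Finset.card_pos.1 (by omega : 0 < (O.erase p).card)
    have hc2 := Finset.card_erase_of_mem hq
    obtain ⟨U, s, σ, hall, hneg, hinv, hcard, hs, hs0, hσ⟩ :=
      ih ((O.erase p).erase q) (by omega) (by omega)
    obtain ⟨hqp, hqO⟩ := Finset.mem_erase.1 hq
    set Z := Finset.univ.filter fun x : A => x + x = 0 with hZ
    set T := Finset.univ \ (Z ∪ U) with hT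
    have hTmem : ∀ x, x ∈ T ↔ x + x ≠ 0 ∧ x ∉ U := by simp [hT, hZ]
    have hTcard : T.card + (Z ∪ U).card = Fintype.card A := by
      rw [← Finset.card_univ]
      exact Finset.card_sdiff_add_card_eq_card (Finset.subset_univ _)
    have hZU := Finset.card_union_le Z U
    have hnegdouble : ∀ x : A, -x + -x = -(x + x) := fun x => (neg_add x x).symm
    -- T is large enough: Z and U each hold at most a fifth of the group, the latter since |U| ≤
    -- 3(|O| - 2).
    obtain ⟨B, hBT, hBcard, hBneg, d, hd⟩ := exists_odd_block T
      (fun x hx => ((hTmem x).1 hx).1) (by omega)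
    set B' := B.image (fun x => -x) with hB'
    have hB'mem : ∀ x, x ∈ B' ↔ -x ∈ B := fun x => by
      simp only [hB', Finset.mem_image]
      exact ⟨fun ⟨y, hy, h⟩ => by rw [← h, neg_neg]; exact hy, fun h => ⟨-x, h, neg_neg x⟩⟩
    have hB'card : B'.card = B.card := Finset.card_image_of_injective _ neg_injective
    have hB'sum : ∑ x ∈ B', x = -d + -d := by
      rw [hB', Finset.sum_image (fun x _ y _ h => neg_injective h), Finset.sum_neg_distrib, hd,
        neg_add]
    have hBB' : Disjoint B B' := Finset.disjoint_left.2 fun x hx hx' =>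
      hBneg x hx ((hB'mem x).1 hx')
    have hdU : Disjoint (B ∪ B') U := by
      refine Finset.disjoint_left.2 fun x hx hxU => ?_
      rcases Finset.mem_union.1 hx with hx | hx
      · exact ((hTmem x).1 (hBT hx)).2 hxU
      · exact ((hTmem _).1 (hBT ((hB'mem x).1 hx))).2 (hneg x hxU)
    have hnew := ((IsAllocation.single B p).union (.single B' q) hBB').union hall hdU
    rw [hB'card, hd, hB'sum] at hnew
    have hsp := hs0 p (by simp)
    have hsq := hs0 q (by simp)
    refine ⟨_, _, _, hnew, ?_, ?_, ?_, ?_, ?_, ?_⟩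
    · intro x hx
      simp only [Finset.mem_union, hB'mem, neg_neg] at hx ⊢
      rcases hx with (hx | hx) | hx
      · exact Or.inl (Or.inr hx)
      · exact Or.inl (Or.inl hx)
      · exact Or.inr (hneg x hx)
    · intro x hx
      simp only [Finset.mem_union, hB'mem] at hx
      rcases hx with (hx | hx) | hx
      · exact ((hTmem x).1 (hBT hx)).1
      · have := ((hTmem _).1 (hBT hx)).1
        rw [hnegdouble] at this
        exact neg_ne_zero.1 this
      · exact hinv x hx
    · have h3 := Finset.card_union_le (B ∪ B') U
      have h4 := Finset.card_union_le B B'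
      omega
    · intro x hx
      by_cases hxp : x = p
      · subst hxp
        simpa [Pi.single_eq_of_ne (Ne.symm hqp), hsp.1] using hBcard
      · by_cases hxq : x = q
        · subst hxq
          simpa [Pi.single_eq_of_ne hxp, hsq.1] using hBcard
        · simpa [Pi.single_eq_of_ne hxp, Pi.single_eq_of_ne hxq] using
            hs x (by simp [hxp, hxq, hx])
    · intro x hx
      have hxp : x ≠ p := fun h => hx (h ▸ hp)
      have hxq : x ≠ q := fun h => hx (h ▸ hqO)
      simpa [Pi.single_eq_of_ne hxp, Pi.single_eq_of_ne hxq] using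
        hs0 x (by simp [hx])
    · intro x
      by_cases hxp : x = p
      · subst hxp
        exact ⟨d, by simp [Pi.single_eq_of_ne (Ne.symm hqp), hsp.2]⟩
      · by_cases hxq : x = q
        · subst hxq
          exact ⟨-d, by simp [Pi.single_eq_of_ne hxp, hsq.2]⟩
        · simpa [Pi.single_eq_of_ne hxp, Pi.single_eq_of_ne hxq] using hσ x

/-- An allocation of a symmetric set that contains all involutions extends to the whole group
without changing the sums, as long as the missing sizes are even. -/
theorem IsAllocation.extend [DecidableEq P] [Fintype P] [Nonempty P] [Fintype A] {R : Finset A}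
    {s s' : P → ℕ} {σ : P → A} (h : IsAllocation R s' σ) (hneg : ∀ x ∈ R, -x ∈ R)
    (hR : ∀ x, x + x = 0 → x ∈ R) (hle : s' ≤ s) (heven : ∀ p, Even (s p - s' p))
    (hs : ∑ p, s p = Fintype.card A) : IsAllocation Finset.univ s σ := by
  have hcard := Finset.card_sdiff_add_card_eq_card (Finset.subset_univ R)
  have hsum : ∑ p, (s - s' : P → ℕ) p + ∑ p, s' p = ∑ p, s p := by
    rw [← Finset.sum_add_distrib]
    exact Finset.sum_congr rfl fun p _ => tsub_add_cancel_of_le (hle p)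
  have hc := h.card_eq
  rw [Finset.card_univ] at hcard
  have := h.union (IsAllocation.of_symm (s - s') heven (Finset.univ \ R)
    (fun x hx => by
      simp only [Finset.mem_sdiff, Finset.mem_univ, true_and] at hx ⊢
      exact fun h => hx (by simpa using hneg _ h))
    (fun x hx h => by simp [hR x h] at hx) (by omega)) Finset.disjoint_sdiff
  rwa [Finset.union_sdiff_of_subset (Finset.subset_univ R), add_tsub_cancel_of_le hle,
    add_zero] at this

theorem exists_symm_subset (T : Finset A) (hneg : ∀ x ∈ T, -x ∈ T)
    (hinv : ∀ x ∈ T, x + x ≠ 0) (j : ℕ) (hj : 2 * j ≤ T.card) :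
    ∃ T' ⊆ T, (∀ x ∈ T', -x ∈ T') ∧ T'.card = 2 * j := by
  induction j with
  | zero => exact ⟨∅, by simp, by simp, by simp⟩
  | succ j ih =>
    obtain ⟨T', hsub, hneg', hcard⟩ := ih (by omega)
    obtain ⟨x, hx⟩ : (T \ T').Nonempty := by
      rw [← Finset.card_pos]
      have := Finset.card_sdiff_add_card_eq_card hsub
      omega
    obtain ⟨hxT, hxT'⟩ := Finset.mem_sdiff.1 hx
    have hne : x ≠ -x := fun h => hinv x hxT (by nth_rewrite 2 [h]; simp)
    refine ⟨insert x (insert (-x) T'), ?_, ?_, ?_⟩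
    · simp [Finset.insert_subset_iff, hsub, hxT, hneg x hxT]
    · intro y hy
      simp only [Finset.mem_insert] at hy ⊢
      rcases hy with rfl | rfl | hy
      · simp
      · simp
      · exact Or.inr (Or.inr (hneg' y hy))
    · rw [Finset.card_insert_of_notMem, Finset.card_insert_of_notMem, hcard]
      · ring
      · exact fun h => hxT' (by simpa using hneg' _ h)
      · simp [hne, hxT']

end Allocation

/-! ### Allocations in groups of odd order and of order divisible by four. -/

section Allocation

variable {A ι : Type*} [AddCommGroup A] [Fintype A] [DecidableEq A] [Fintype ι] [DecidableEq ι]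

/-- The number of elements of order at most two divides every `n` such that `m * n` is the order of
the group and `m` is odd. -/
theorem card_two_torsion_dvd {m n : ℕ} (hm : Odd m) (hA : Fintype.card A = m * n) :
    (Finset.univ.filter fun x : A => x + x = 0).card ∣ n := by
  let K : AddSubgroup A := (nsmulAddMonoidHom (α := A) 2).ker
  have hK : ∀ x : A, x ∈ K ↔ x + x = 0 := fun x => by
    simp [K, AddMonoidHom.mem_ker, two_nsmul]
  have hcard : (Finset.univ.filter fun x : A => x + x = 0).card = Nat.card K := by
    rw [← Nat.card_eq_finsetCard]
    exact Nat.card_congr (Equiv.subtypeEquivRight fun x => by simp [hK])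
  rw [hcard]
  have hdvd : Nat.card K ∣ m * n := by
    rw [← hA, ← Nat.card_eq_fintype_card]
    exact AddSubgroup.card_addSubgroup_dvd_card K
  -- By Cauchy, 2 is the only prime that can divide the order of K, and m is odd.
  refine Nat.Coprime.dvd_of_dvd_mul_left ?_ hdvd
  by_contra hc
  obtain ⟨p, hp, hpK, hpm⟩ := Nat.Prime.not_coprime_iff_dvd.1 hc
  have := Fact.mk hp
  obtain ⟨x, hx⟩ := exists_prime_addOrderOf_dvd_card' p hpK
  have h2 : addOrderOf x ∣ 2 := by
    rw [addOrderOf_dvd_iff_nsmul_eq_zero, two_nsmul]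
    exact Subtype.ext ((hK _).1 x.2)
  rw [hx, Nat.prime_dvd_prime_iff_eq hp Nat.prime_two] at h2
  subst h2
  exact (Nat.not_even_iff_odd.2 hm) (even_iff_two_dvd.2 hpm)

theorem exists_involution {A : Type*} [AddCommGroup A] [Fintype A] (hA : 2 ∣ Fintype.card A) : ∃ a : A, a ≠ 0 ∧ a + a = 0 := by
  have := Fact.mk Nat.prime_two
  obtain ⟨a, ha⟩ := exists_prime_addOrderOf_dvd_card 2 hA
  refine ⟨a, fun h => ?_, ?_⟩
  · rw [h, addOrderOf_zero] at ha
    omega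
  · rw [← two_nsmul, ← ha, addOrderOf_nsmul_eq_zero]

/-- In a group whose order is divisible by four, a unique involution is a double. -/
theorem exists_half_of_unique_involution (hA : 4 ∣ Fintype.card A) {a : A} (ha : a ≠ 0)
    (ha2 : a + a = 0) (huniq : ∀ x : A, x + x = 0 → x = 0 ∨ x = a) : ∃ b, a = b + b := by
  let D : A →+ A := nsmulAddMonoidHom 2
  have hD : ∀ x : A, D x = x + x := fun x => by simp [D, two_nsmul]
  have hker : Nat.card D.ker = 2 := by
    rw [Nat.card_congr (Equiv.subtypeEquivRight (q := fun x => x ∈ ({0, a} : Finset A)) fun x => by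
      rw [AddMonoidHom.mem_ker, hD]
      simp only [Finset.mem_insert, Finset.mem_singleton]
      exact ⟨huniq x, by rintro (rfl | rfl) <;> simp [ha2]⟩)]
    rw [Nat.card_eq_finsetCard, Finset.card_pair ha.symm]
  have hmul := AddSubgroup.card_mul_index D.ker
  rw [AddSubgroup.index_ker, hker, Nat.card_eq_fintype_card (α := A)] at hmul
  classical
  -- The doubles form a subgroup of order |A| / 2, still even, so one of them is an involution,
  -- necessarily a.
  obtain ⟨x, hx0, hx2⟩ := exists_involution (A := D.range) (by
    rw [← Nat.card_eq_fintype_card]; omega)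
  obtain ⟨y, hy⟩ := x.2
  have hx2' : (x : A) + x = 0 := by exact_mod_cast congrArg Subtype.val hx2
  rcases huniq x hx2' with h | h
  · exact absurd (Subtype.ext h) hx0
  · exact ⟨y, by rw [← h, ← hy, hD]⟩

/-- Doubling is a bijection, so only the indices outside `NB` (the bipartite components) impose a
condition; their sizes are even and pairs {x, -x} give them sum zero. The other parts take arbitrary
remaining elements. -/
theorem exists_allocation_of_odd {m : ℕ} (hA : Odd (Fintype.card A)) (k : ι × Bool → ℕ)
    (NB : ι → Prop) (hstrict : ∀ i, ¬ NB i → ∀ b, Even (k (i, b)))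
    (hk : m * ∑ p, k p ≤ Fintype.card A) (hι : Nonempty ι) :
    ∃ (R : Finset A) (σ : ι × Bool → A), IsAllocation R (fun p => m * k p) σ ∧
      (∀ i, ¬ NB i → ∀ b, σ (i, b) = 0) ∧ ∀ p, ∃ d, σ p = d + d := by
  classical
  have hinj : Function.Injective fun x : A => x + x := by
    intro x y hxy
    by_contra hne
    have h2 : 2 ∣ Fintype.card A := by
      have : addOrderOf (x - y) ∣ 2 := by
        rw [addOrderOf_dvd_iff_nsmul_eq_zero, two_nsmul]
        have hxy : x + x = y + y := hxy
        calc x - y + (x - y) = (x + x) - (y + y) := by abel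
          _ = 0 := by rw [hxy, sub_self]
      rcases (Nat.dvd_prime Nat.prime_two).1 this with h | h
      · exact absurd (AddMonoid.addOrderOf_eq_one_iff.1 h) (sub_ne_zero.2 hne)
      · rw [← h]; exact addOrderOf_dvd_card
    exact (Nat.not_even_iff_odd.2 hA) (even_iff_two_dvd.2 h2)
  have hsurj := Finite.surjective_of_injective hinj
  let s0 : ι × Bool → ℕ := fun p => if NB p.1 then 0 else m * k p
  have hs0 : ∀ p, Even (s0 p) := fun p => by
    by_cases h : NB p.1
    · simp [s0, h]
    · simpa [s0, h] using (hstrict p.1 h p.2).mul_left m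
  have hle : s0 ≤ fun p => m * k p := fun p => by
    by_cases h : NB p.1 <;> simp [s0, h]
  have hsum : ∑ p, ((fun p => m * k p) - s0 : ι × Bool → ℕ) p + ∑ p, s0 p = ∑ p, m * k p := by
    rw [← Finset.sum_add_distrib]
    exact Finset.sum_congr rfl fun p _ => tsub_add_cancel_of_le (hle p)
  rw [Finset.mul_sum] at hk
  obtain ⟨j, hj⟩ : Even (∑ p, s0 p) := Finset.even_sum _ fun p _ => hs0 p
  obtain ⟨e, he⟩ := hA
  have hcard0 : (Finset.univ.erase (0 : A)).card = Fintype.card A - 1 := by simp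
  have hinv : ∀ x ∈ Finset.univ.erase (0 : A), x + x ≠ 0 := fun x hx h =>
    (Finset.mem_erase.1 hx).1 (hinj (by simpa using h))
  -- The pairs must avoid 0; there is room, since 2j is even and at most the odd number |A|.
  obtain ⟨T, hTsub, hTneg, hT⟩ := exists_symm_subset (Finset.univ.erase (0 : A))
    (by simp) hinv j (by omega)
  have hTcard := Finset.card_sdiff_add_card_eq_card (Finset.subset_univ T)
  rw [Finset.card_univ] at hTcard
  obtain ⟨R, hRsub, hR⟩ := Finset.exists_subset_card_eq (s := Finset.univ \ T)
    (n := ∑ p, ((fun p => m * k p) - s0 : ι × Bool → ℕ) p) (by omega)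
  obtain ⟨σ, hσ⟩ := IsAllocation.exists_of_card _ R hR
  have hall := (IsAllocation.of_symm s0 hs0 T hTneg (fun x hx => hinv x (hTsub hx))
    (by omega)).union hσ (Finset.disjoint_of_subset_right hRsub Finset.disjoint_sdiff)
  rw [add_tsub_cancel_of_le hle, zero_add] at hall
  refine ⟨_, _, hall, fun i hi b => ?_, fun p => ?_⟩
  · obtain ⟨φ, hφ⟩ := hσ
    have h := hφ (i, b)
    have h0 : ((fun p => m * k p) - s0 : ι × Bool → ℕ) (i, b) = 0 := by simp [s0, hi]
    rw [h0, Finset.card_eq_zero] at h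
    rw [← h.2, h.1, Finset.sum_empty]
  · obtain ⟨d, hd⟩ := hsurj (σ p)
    exact ⟨d, hd.symm⟩

/-- Here every element must be placed. A symmetric set U settles the odd parts, the set Z of
solutions of 2x = 0 is placed according to the number of involutions, and `IsAllocation.extend`
fills the rest with pairs. If all components are bipartite, U is not needed. -/
theorem exists_allocation_of_four_dvd {m n : ℕ} (hm : Odd m) (hm5 : 5 ≤ m) (hn : 4 ∣ n)
    (hA : Fintype.card A = m * n) (k : ι × Bool → ℕ) (NB : ι → Prop)
    (hstrict : ∀ i, ¬ NB i → ∀ b, Even (k (i, b)) ∧ 0 < k (i, b))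
    (hloose : ∀ i, NB i → 2 ≤ k (i, false) ∧ k (i, true) = 0)
    (hk : ∑ p, k p = n) (hι : Nonempty ι) :
    ∃ σ : ι × Bool → A, IsAllocation Finset.univ (fun p => m * k p) σ ∧
      (∀ i, ¬ NB i → σ (i, true) = σ (i, false)) ∧ ∀ i, NB i → ∀ b, ∃ d, σ (i, b) = d + d := by
  classical
  have hnpos : 0 < n := by
    rcases Nat.eq_zero_or_pos n with rfl | h
    · have := Fintype.card_pos (α := A); omega
    · exact h
  have hN4 : 4 ∣ Fintype.card A := hA ▸ hn.mul_left m
  have hs : ∑ p, m * k p = Fintype.card A := by rw [← Finset.mul_sum, hk, hA]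
  set Z := Finset.univ.filter fun x : A => x + x = 0 with hZ
  have hZn : Z.card ≤ n := Nat.le_of_dvd hnpos (card_two_torsion_dvd hm hA)
  have hZ5 : 5 * Z.card ≤ Fintype.card A := by rw [hA]; exact Nat.mul_le_mul hm5 hZn
  have hZneg : ∀ x ∈ Z, -x ∈ Z := fun x hx => by
    simp only [hZ, Finset.mem_filter, Finset.mem_univ, true_and] at hx ⊢
    rw [← neg_add, hx, neg_zero]
  have hZmem : ∀ x, x ∈ Z ↔ x + x = 0 := by simp [hZ]
  -- As m is odd, these are the parts that receive an odd number of elements. They all come from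
  -- `NB`, where sizes are at least 2, hence at least 3 when odd.
  set O := Finset.univ.filter fun p => Odd (k p) with hO
  have hOeven : Even O.card := by
    rw [hO, ← Finset.even_sum_iff_even_card_odd, hk]
    exact even_iff_two_dvd.2 (dvd_trans (by norm_num) hn)
  have hO3 : ∀ p ∈ O, NB p.1 ∧ 3 ≤ k p := by
    rintro ⟨i, b⟩ hp
    have hodd : Odd (k (i, b)) := by simpa [hO] using hp
    have hNB : NB i := by
      by_contra h
      exact (Nat.not_even_iff_odd.2 hodd) (hstrict i h b).1
    refine ⟨hNB, ?_⟩
    obtain ⟨h1, h2⟩ := hloose i hNB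
    obtain ⟨d, hd⟩ := hodd
    cases b <;> omega
  have hO15 : 15 * O.card ≤ Fintype.card A := by
    rw [← hs]
    calc 15 * O.card = ∑ p ∈ O, 15 := by simp [mul_comm]
      _ ≤ ∑ p ∈ O, m * k p := Finset.sum_le_sum fun p hp => by
          calc 15 = 5 * 3 := rfl
            _ ≤ m * k p := Nat.mul_le_mul hm5 (hO3 p hp).2
      _ ≤ _ := Finset.sum_le_sum_of_subset (Finset.subset_univ O)
  obtain ⟨j, hj⟩ := hOeven
  obtain ⟨U, s, σ, hall, hUneg, hUinv, hUcard, hsO, hs0, hσ⟩ :=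
    exists_odd_allocation (P := ι × Bool) hZ5 j O (by omega) hO15
  have hle : s ≤ fun p => m * k p := fun p => by
    by_cases hp : p ∈ O
    · have := hsO p hp
      have : 5 * 3 ≤ m * k p := Nat.mul_le_mul hm5 (hO3 p hp).2
      show s p ≤ m * k p
      omega
    · rw [(hs0 p hp).1]; exact Nat.zero_le _
  have heven : ∀ p, Even (m * k p - s p) := fun p => by
    by_cases hp : p ∈ O
    · have h1 : Odd (k p) := by simpa [hO] using hp
      have h2 : Odd (s p) := by rcases hsO p hp with h | h <;> rw [h] <;> decide
      exact Nat.Odd.sub_odd (hm.mul h1) h2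
    · have h1 : Even (k p) := by simpa [hO] using hp
      rw [(hs0 p hp).1, Nat.sub_zero]
      exact h1.mul_left m
  -- Room left after the odd blocks: at least 15 - 3 for an odd part, at least 5 * 2 for an even
  -- one.
  have hge : ∀ p, 0 < k p → 10 ≤ m * k p - s p := fun p hpos => by
    by_cases hp : p ∈ O
    · have := hsO p hp
      have : 5 * 3 ≤ m * k p := Nat.mul_le_mul hm5 (hO3 p hp).2
      omega
    · have h1 : Even (k p) := by simpa [hO] using hp
      obtain ⟨d, hd⟩ := h1
      have : 5 * 2 ≤ m * k p := Nat.mul_le_mul hm5 (by omega)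
      have := (hs0 p hp).1
      omega
  have hdisj : Disjoint U Z := Finset.disjoint_left.2 fun x hx hxZ =>
    hUinv x hx ((hZmem x).1 hxZ)
  have hneg : ∀ x ∈ U ∪ Z, -x ∈ U ∪ Z := fun x hx => by
    rw [Finset.mem_union] at hx ⊢
    exact hx.imp (hUneg x) (hZneg x)
  have hsub : ∀ x, x + x = 0 → x ∈ U ∪ Z := fun x hx =>
    Finset.mem_union_right _ ((hZmem x).2 hx)
  obtain ⟨a, ha, ha2⟩ := exists_involution (A := A) (dvd_trans (by norm_num) hN4)
  by_cases huniq : ∀ x : A, x + x = 0 → x = 0 ∨ x = a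
  · obtain ⟨b, hb⟩ := exists_half_of_unique_involution hN4 ha ha2 huniq
    have hZa : Z = {0, a} := by
      ext x
      simp only [hZmem, Finset.mem_insert, Finset.mem_singleton]
      exact ⟨huniq x, by rintro (rfl | rfl) <;> simp [ha2]⟩
    by_cases hNB : ∃ i, NB i
    -- A non-bipartite component can absorb 0 and a together: their sum a = b + b is a double.
    · obtain ⟨i, hi⟩ := hNB
      have h10 := hge (i, false) (by have := hloose i hi; omega)
      have hall' := (hall.union (.single Z (i, false)) hdisj).extend
        (s := fun p => m * k p) hneg hsub ?_ ?_ hs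
      · refine ⟨_, hall', fun i' hi' => ?_, fun i' hi' b' => ?_⟩
        · have hne : i' ≠ i := fun h => hi' (h ▸ hi)
          have h0 : ∀ b, σ (i', b) = 0 := fun b => (hs0 (i', b) fun h => hi' (hO3 _ h).1).2
          simp [h0, hne]
        · obtain ⟨d, hd⟩ := hσ (i', b')
          by_cases hp : (i', b') = (i, false)
          · refine ⟨d + b, ?_⟩
            rw [Pi.add_apply, hd, hp, Pi.single_eq_same, hZa, Finset.sum_pair ha.symm, zero_add, hb]
            abel
          · exact ⟨d, by rw [Pi.add_apply, hd, Pi.single_eq_of_ne hp, add_zero]⟩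
      · intro p
        have h1 := hle p
        by_cases hp : p = (i, false)
        · subst hp
          simp [hZa, Finset.card_pair ha.symm]
          omega
        · simpa [Pi.single_eq_of_ne hp] using h1
      · intro p
        by_cases hp : p = (i, false)
        · subst hp
          have := heven (i, false)
          simp only [Pi.add_apply, Pi.single_eq_same, hZa, Finset.card_pair ha.symm]
          rw [← Nat.sub_sub]
          exact (Nat.even_sub (by omega)).2 (by simp [this])
        · simpa [Pi.single_eq_of_ne hp] using heven p
    -- All components are bipartite, so the classes of one of them must absorb 0 and a with equal
    -- sums: {a, b} and {0, -b} work, because a + b = -a + b = -b.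
    · push Not at hNB
      obtain ⟨i⟩ := id hι
      have hb2 : b + b ≠ 0 := hb ▸ ha
      have hb0 : b ≠ 0 := by rintro rfl; simp at hb2
      have hbn : b ≠ -b := fun h => hb2 (by nth_rewrite 2 [h]; simp)
      have hab : a ≠ b := fun h => hb0 (by rw [h] at hb; simpa using hb)
      have ha' : -a = a := neg_eq_of_add_eq_zero_left ha2
      have han : a ≠ -b := fun h => hab (by rw [← ha', h, neg_neg])
      have hc1 : ({a, b} : Finset A).card = 2 := Finset.card_pair hab
      have hc2 : ({0, -b} : Finset A).card = 2 := Finset.card_pair (neg_ne_zero.2 hb0).symm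
      have hd : Disjoint ({a, b} : Finset A) {0, -b} := by
        simp [ha.symm, hb0.symm, han.symm, hbn.symm]
      have hk2 : ∀ p, 10 ≤ m * k p := fun p => by
        obtain ⟨⟨d, hd⟩, hpos⟩ : Even (k p) ∧ 0 < k p := hstrict p.1 (hNB _) p.2
        calc 10 = 5 * 2 := rfl
          _ ≤ m * k p := Nat.mul_le_mul hm5 (by omega)
      have hke : ∀ p, Even (m * k p) := fun p => (hstrict p.1 (hNB _) p.2).1.mul_left m
      have hpieces := (IsAllocation.single ({a, b} : Finset A) (i, true)).union
        (.single {0, -b} (i, false)) hd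
      rw [hc1, hc2] at hpieces
      have hval : ∀ p, (Pi.single (i, true) 2 + Pi.single (i, false) 2 : ι × Bool → ℕ) p = 0 ∨
          (Pi.single (i, true) 2 + Pi.single (i, false) 2 : ι × Bool → ℕ) p = 2 := by
        rintro ⟨i', b'⟩
        by_cases h : i' = i <;> cases b' <;> simp [h]
      have hall' := hpieces.extend (s := fun p => m * k p) ?_ ?_ ?_ ?_ hs
      · refine ⟨_, hall', fun i' _ => ?_, fun i' hi' => absurd hi' (hNB i')⟩
        by_cases h : i' = i
        · subst h
          simp [Finset.sum_pair hab, Finset.sum_pair (show (0 : A) ≠ -b from (neg_ne_zero.2 hb0).symm)]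
          have : a + b = -a + b := by rw [ha']
          rw [this, hb]; abel_nf
        · simp [h]
      · intro x hx
        simp only [Finset.mem_union, Finset.mem_insert, Finset.mem_singleton] at hx ⊢
        rcases hx with (rfl | rfl) | (rfl | rfl) <;> simp [ha']
      · intro x hx
        rcases huniq x hx with rfl | rfl <;> simp
      · intro p
        have h1 := hk2 p
        show _ ≤ m * k p
        rcases hval p with h | h <;> omega
      · intro p
        have h1 := hk2 p
        have h2 := hke p
        rcases hval p with h | h <;> rw [h]
        · simpa using h2
        · exact (Nat.even_sub (by omega)).2 (by simp [h2])
  · push Not at huniq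
    obtain ⟨b, hb2, hb, hab⟩ := huniq
    -- Rounding down to multiples of 4 loses at most a fifth of an even number that is at least 10
    -- (10 itself is the extreme case). So the quadruples have room for 4/5 of |A| - |U|, while |U|
    -- and |Z| are each at most |A| / 5.
    have hcap : Z.card ≤ 4 * ∑ p, ((fun p => m * k p) - s : ι × Bool → ℕ) p / 4 := by
      have h1 : ∑ p, ((fun p => m * k p) - s : ι × Bool → ℕ) p ≤
          5 * ∑ p, ((fun p => m * k p) - s : ι × Bool → ℕ) p / 4 := by
        rw [Finset.mul_sum]
        refine Finset.sum_le_sum fun p _ => ?_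
        show m * k p - s p ≤ 5 * ((m * k p - s p) / 4)
        rcases Nat.eq_zero_or_pos (k p) with h | h
        · simp [h]
        · have := hge p h
          obtain ⟨d, hd⟩ := heven p
          omega
      have h2 : ∑ p, ((fun p => m * k p) - s : ι × Bool → ℕ) p + ∑ p, s p = ∑ p, m * k p := by
        rw [← Finset.sum_add_distrib]
        exact Finset.sum_congr rfl fun p _ => tsub_add_cancel_of_le (hle p)
      have h3 := hall.card_eq
      omega
    obtain ⟨s', hs', hs'even, hZall⟩ := IsAllocation.of_translate _ ha hb hab.symm ha2 hb2 Z
      (fun x => (hZmem x).1)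
      (fun x hx => (hZmem _).2 (by rw [add_add_add_comm, (hZmem x).1 hx, ha2, add_zero]))
      (fun x hx => (hZmem _).2 (by rw [add_add_add_comm, (hZmem x).1 hx, hb2, add_zero])) hcap
    have hs'p : ∀ p, s' p ≤ m * k p - s p := hs'
    have hall' := (hall.union hZall hdisj).extend (s := fun p => m * k p) hneg hsub ?_ ?_ hs
    · rw [add_zero] at hall'
      refine ⟨_, hall', fun i hi => ?_, fun i _ b => hσ (i, b)⟩
      have h0 : ∀ b, σ (i, b) = 0 := fun b => (hs0 (i, b) fun h => hi (hO3 _ h).1).2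
      rw [h0, h0]
    · intro p
      have := hs'p p
      have h1 : s p ≤ m * k p := hle p
      show s p + s' p ≤ m * k p
      omega
    · intro p
      have := hs'p p
      show Even (m * k p - (s p + s' p))
      rw [← Nat.sub_sub, Nat.even_sub this]
      simp [heven p, hs'even p]

end Allocation

/-- Fibers of equal size over each part glue to a bijection from X onto R, which serves as the
injective weight function. -/
theorem IsAllocation.exists_labeling {A P X : Type*} [AddCommGroup A] [DecidableEq P] [Fintype X]
    {R : Finset A} {s : P → ℕ} {σ : P → A} (h : IsAllocation R s σ) (f : X → P)
    (hf : ∀ p, (Finset.univ.filter (f · = p)).card = s p) :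
    ∃ w : X → A, Function.Injective w ∧ ∀ p, ∑ x with f x = p, w x = σ p := by
  classical
  obtain ⟨φ, hφ⟩ := h
  have hcard : ∀ p, Fintype.card {x // f x = p} = Fintype.card {y : R // φ y = p} := fun p => by
    rw [Fintype.card_subtype, hf, ← (hφ p).1, Fintype.card_subtype,
      ← Finset.card_map (Function.Embedding.subtype _)]
    congr 1
    ext y
    simp [and_comm]
  let e : X ≃ R := Equiv.ofFiberEquiv (f := f) (g := fun y : R => φ y)
    fun p => Fintype.equivOfCardEq (hcard p)
  have he : ∀ x, φ (e x) = f x := fun x =>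
    Equiv.ofFiberEquiv_map (g := fun y : R => φ y) (fun p => Fintype.equivOfCardEq (hcard p)) x
  refine ⟨fun x => e x, Subtype.val_injective.comp e.injective, fun p => ?_⟩
  rw [← (hφ p).2]
  refine Finset.sum_bij (fun x _ => (e x : A)) ?_ ?_ ?_ ?_
  · intro x hx
    simpa [he] using hx
  · intro x _ y _ hxy
    exact e.injective (Subtype.ext hxy)
  · intro y hy
    rw [Finset.mem_filter] at hy
    refine ⟨e.symm ⟨y, hy.1⟩, ?_, by simp⟩
    simp [← he, hy.2]
  · intro x _; rfl

/-! ### Which vertex weights come from edge labelings. -/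

namespace SimpleGraph

section Realize

variable {V W A : Type*} [AddCommGroup A]

/-- The weighted degrees as a homomorphism from labelings to vertex weights. -/
noncomputable def weightedDegreeHom [Fintype W] (G : SimpleGraph W) (A : Type*) [AddCommGroup A] :
    (G.edgeSet → A) →+ (W → A) where
  toFun := G.weightedDegree
  map_zero' := by
    funext v
    simp [weightedDegree]
  map_add' f g := by
    funext v
    simp [weightedDegree, Finset.sum_add_distrib]

theorem weightedDegreeHom_single [Fintype W] [DecidableEq W] (G : SimpleGraph W)
    [DecidableEq G.edgeSet] {x y : W} (h : G.Adj x y) (a : A) :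
    G.weightedDegreeHom A (Pi.single ⟨s(x, y), h⟩ a) = Pi.single x a + Pi.single y a := by
  funext v
  show G.weightedDegree _ v = _
  unfold weightedDegree
  by_cases hx : v = x
  · subst hx
    rw [Finset.sum_eq_single ⟨y, h⟩]
    · simp [Pi.single_eq_of_ne h.ne]
    · intro u _ hu
      refine Pi.single_eq_of_ne (fun h' => hu ?_) _
      have h'' : s(v, (u : W)) = s(v, y) := congrArg Subtype.val h'
      exact Subtype.ext (Sym2.congr_right.1 h'')
    · simp
  by_cases hy : v = y
  · subst hy
    rw [Finset.sum_eq_single ⟨x, h.symm⟩]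
    · have : (⟨s(v, x), h.symm⟩ : G.edgeSet) = ⟨s(x, v), h⟩ := Subtype.ext Sym2.eq_swap
      simp [Pi.single_eq_of_ne h.ne', this]
    · intro u _ hu
      refine Pi.single_eq_of_ne (fun h' => hu ?_) _
      have h'' : s(v, (u : W)) = s(v, x) := (congrArg Subtype.val h').trans Sym2.eq_swap
      exact Subtype.ext (Sym2.congr_right.1 h'')
    · simp
  · rw [Finset.sum_eq_zero, Pi.add_apply, Pi.single_eq_of_ne hx, Pi.single_eq_of_ne hy, add_zero]
    intro u _
    refine Pi.single_eq_of_ne (fun h' => ?_) _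
    have h'' : s(v, (u : W)) = s(x, y) := congrArg Subtype.val h'
    rcases Sym2.eq_iff.1 h'' with h | h
    · exact hx h.1
    · exact hy h.1

theorem single_add_single_mem_range [Fintype W] [DecidableEq W] (G : SimpleGraph W) {x y : W}
    (h : G.Adj x y) (a : A) :
    (Pi.single x a + Pi.single y a : W → A) ∈ (G.weightedDegreeHom A).range := by
  classical
  exact ⟨_, G.weightedDegreeHom_single h a⟩

/-- The sum of all weighted degrees is twice the sum of all labels. -/
theorem exists_sum_weightedDegree_eq_double [Fintype W] (G : SimpleGraph W) (f : G.edgeSet → A) :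
    ∃ d, ∑ v, G.weightedDegree f v = d + d := by
  classical
  let S : (W → A) →+ A := ∑ v, Pi.evalAddMonoidHom (fun _ => A) v
  have hS : ∀ w : W → A, S w = ∑ v, w v := fun w => by simp [S]
  have hsingle : ∀ (e : G.edgeSet) (a : A), S (G.weightedDegreeHom A (Pi.single e a)) = a + a := by
    rintro ⟨⟨x, y⟩, h⟩ a
    have : G.weightedDegreeHom A (Pi.single ⟨s(x, y), h⟩ a) = Pi.single x a + Pi.single y a :=
      G.weightedDegreeHom_single h a
    refine (congrArg S this).trans ?_
    rw [map_add, hS, hS]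
    simp
  refine ⟨∑ e, f e, ?_⟩
  calc ∑ v, G.weightedDegree f v = S (G.weightedDegreeHom A f) := (hS _).symm
    _ = S (G.weightedDegreeHom A (∑ e, Pi.single e (f e))) := by rw [Finset.univ_sum_single]
    _ = ∑ e, (f e + f e) := by simp only [map_sum, hsingle]
    _ = _ := Finset.sum_add_distrib

/-- Edge generators with alternating signs telescope along the walk. A change of layer over a fixed
vertex of H goes through a common neighbor, which exists since H has no isolated vertices. -/
theorem single_sub_single_mem_range [Fintype V] [DecidableEq V] {m : ℕ} (H : SimpleGraph V)
    (hiso : ∀ v : V, ∃ w : V, H.Adj v w) {u v : V} (p : H.Walk u v) (i j : Fin m) (a : A) :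
    (Pi.single (u, i) a - (-1 : ℤ) ^ p.length • Pi.single (v, j) a : V × Fin m → A) ∈
      ((H.lexProduct (⊥ : SimpleGraph (Fin m))).weightedDegreeHom A).range := by
  induction p generalizing i with
  | @nil u =>
    obtain ⟨w, hw⟩ := hiso u
    have h1 := single_add_single_mem_range (H.lexProduct (⊥ : SimpleGraph (Fin m)))
      (x := (u, i)) (y := (w, j)) (Or.inl hw) a
    have h2 := single_add_single_mem_range (H.lexProduct (⊥ : SimpleGraph (Fin m)))
      (x := (u, j)) (y := (w, j)) (Or.inl hw) a
    simpa using sub_mem h1 h2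
  | @cons u w v h p ih =>
    have h1 := single_add_single_mem_range (H.lexProduct (⊥ : SimpleGraph (Fin m)))
      (x := (u, i)) (y := (w, i)) (Or.inl h) a
    convert sub_mem h1 (ih i) using 1
    rw [Walk.length_cons, pow_succ, mul_neg_one, neg_smul]
    abel

/-- Roots of the components and the parities of walks to the roots: a component without odd closed
walk at its root is bipartite, and the parities are its color classes. -/
theorem exists_walk_parity [Fintype V] [DecidableEq V] (H : SimpleGraph V)
    [DecidableEq H.ConnectedComponent]
    (hiso : ∀ v : V, ∃ w : V, H.Adj v w) (heven : H.BipartiteComponentsEven) :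
    ∃ (ρ : H.ConnectedComponent → V) (ε : V → Bool),
      (∀ c, H.connectedComponentMk (ρ c) = c) ∧
      (∀ v, ∃ p : H.Walk v (ρ (H.connectedComponentMk v)), ε v = true ↔ Odd p.length) ∧
      ∀ c, (¬ ∃ p : H.Walk (ρ c) (ρ c), Odd p.length) →
        ∀ b, Even (Finset.univ.filter fun v => (H.connectedComponentMk v, ε v) = (c, b)).card ∧
          0 < (Finset.univ.filter fun v => (H.connectedComponentMk v, ε v) = (c, b)).card := by
  classical
  let ρ : H.ConnectedComponent → V := fun c => Quot.out c
  have hρ : ∀ c, H.connectedComponentMk (ρ c) = c := fun c => Quot.out_eq c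
  have hreach : ∀ v, H.Reachable v (ρ (H.connectedComponentMk v)) := fun v =>
    ConnectedComponent.exact (hρ _).symm
  choose q _ using fun v => (Reachable.exists_isPath (hreach v))
  let ε : V → Bool := fun v => decide (Odd (q v).length)
  refine ⟨ρ, ε, hρ, fun v => ⟨q v, by simp [ε]⟩, fun c hc b => ?_⟩
  have hw : ∀ v, H.connectedComponentMk v = c →
      ∃ p : H.Walk v (ρ c), (ε v = true ↔ Odd p.length) := by
    rintro v rfl
    exact ⟨q v, by simp [ε]⟩
  have hadj : ∀ u v, H.connectedComponentMk u = c → H.Adj u v → ε u ≠ ε v := by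
    intro u v hu huv hε
    obtain ⟨p, hp⟩ := hw u hu
    obtain ⟨p', hp'⟩ := hw v ((ConnectedComponent.sound huv.symm.reachable).trans hu)
    -- Root to u, across the edge, and back from v: with equal parities at u and v this closed walk
    -- would be odd.
    refine hc ⟨p.reverse.append (Walk.cons huv p'), ?_⟩
    rw [hε] at hp
    have := hp.symm.trans hp'
    simp only [Walk.length_append, Walk.length_reverse, Walk.length_cons]
    by_cases ho : Odd p.length
    · exact ho.add_even ((this.1 ho).add_odd odd_one)
    · exact (Nat.not_odd_iff_even.1 ho).add_odd
        ((Nat.not_odd_iff_even.1 fun h => ho (this.2 h)).add_one)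
  constructor
  · let C : c.toSimpleGraph.Coloring (Fin 2) := Coloring.mk (fun v => if ε v then 1 else 0) (by
      rintro ⟨u, hu⟩ ⟨v, hv⟩ huv
      have := hadj u v ((ConnectedComponent.mem_supp_iff c u).1 hu)
        ((ConnectedComponent.toSimpleGraph_adj c hu hv).1 huv)
      cases h1 : ε u <;> cases h2 : ε v <;> simp_all)
    have h := heven c C (if b then 1 else 0)
    rw [← Nat.card_eq_finsetCard]
    convert h using 1
    refine Nat.card_congr ⟨fun v => ⟨⟨v, ?_⟩, ?_⟩, fun v => ⟨v, ?_⟩, fun _ => rfl, fun _ => rfl⟩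
    · have := v.2
      simp only [Finset.mem_filter, Prod.mk.injEq] at this
      exact (ConnectedComponent.mem_supp_iff c _).2 this.2.1
    · have := v.2
      simp only [Finset.mem_filter, Prod.mk.injEq] at this
      show (if ε v then 1 else 0 : Fin 2) = _
      rw [this.2.2]
    · obtain ⟨⟨v, hv⟩, hv'⟩ := v
      have hv' : (if ε v then 1 else 0 : Fin 2) = if b then 1 else 0 := hv'
      simp only [Finset.mem_filter, Prod.mk.injEq, Finset.mem_univ, true_and]
      refine ⟨(ConnectedComponent.mem_supp_iff c v).1 hv, ?_⟩
      cases h1 : ε v <;> cases b <;> simp_all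
  · obtain ⟨u, hu⟩ := hiso (ρ c)
    rw [Finset.card_pos]
    have h := hadj (ρ c) u (hρ c) hu
    -- Both classes are nonempty: the root and any neighbor of it have different parities.
    by_cases hb : ε (ρ c) = b
    · exact ⟨ρ c, by simp [hρ, hb]⟩
    · refine ⟨u, ?_⟩
      have : H.connectedComponentMk u = c :=
        (ConnectedComponent.sound hu.symm.reachable).trans (hρ c)
      simp only [Finset.mem_filter, Finset.mem_univ, true_and, Prod.mk.injEq, this]
      revert h hb
      cases ε (ρ c) <;> cases ε u <;> cases b <;> simp

/-- Modulo the range, each weight moves to the root of its component with the sign given by `ε`. The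
component then contributes the difference of its two class sums at the root. This vanishes if the
sums agree; otherwise it is twice an element, which an odd closed walk at the root realizes. -/
theorem mem_range_weightedDegreeHom [Fintype V] [DecidableEq V] {m : ℕ} (H : SimpleGraph V)
    [DecidableEq H.ConnectedComponent]
    (hiso : ∀ v : V, ∃ w : V, H.Adj v w) (hm : 0 < m)
    {ρ : H.ConnectedComponent → V} {ε : V → Bool}
    (hε : ∀ v, ∃ p : H.Walk v (ρ (H.connectedComponentMk v)), ε v = true ↔ Odd p.length)
    (w : V × Fin m → A)
    (hw : ∀ c, ((∃ p : H.Walk (ρ c) (ρ c), Odd p.length) ∧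
        ∃ d, ∑ x : V × Fin m with H.connectedComponentMk x.1 = c, w x = d + d) ∨
      ∑ x : V × Fin m with (H.connectedComponentMk x.1, ε x.1) = (c, true), w x =
        ∑ x : V × Fin m with (H.connectedComponentMk x.1, ε x.1) = (c, false), w x) :
    w ∈ ((H.lexProduct (⊥ : SimpleGraph (Fin m))).weightedDegreeHom A).range := by
  classical
  set I := ((H.lexProduct (⊥ : SimpleGraph (Fin m))).weightedDegreeHom A).range
  let i : Fin m := ⟨0, hm⟩
  let t : V × Fin m → A := fun x => if ε x.1 then -w x else w x
  let τ : V × Fin m → (V × Fin m → A) := fun x =>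
    Pi.single (ρ (H.connectedComponentMk x.1), i) (t x)
  have h1 : ∀ x, Pi.single x (w x) - τ x ∈ I := by
    intro x
    obtain ⟨p, hp⟩ := hε x.1
    have := single_sub_single_mem_range H hiso p x.2 i (w x)
    convert this using 2
    by_cases h : ε x.1 = true
    · simp [τ, t, h, (hp.1 h).neg_one_pow, Pi.single_neg]
    · simp [τ, t, h, (Nat.not_odd_iff_even.1 fun h' => h (hp.2 h')).neg_one_pow]
  have h2 : w - ∑ x, τ x ∈ I := by
    have : ∑ x, (Pi.single x (w x) - τ x) ∈ I := sum_mem fun x _ => h1 x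
    rwa [Finset.sum_sub_distrib, Finset.univ_sum_single] at this
  have h3 : ∀ c, ∑ x : V × Fin m with H.connectedComponentMk x.1 = c, τ x ∈ I := by
    intro c
    have hτ : ∑ x : V × Fin m with H.connectedComponentMk x.1 = c, τ x =
        Pi.single (ρ c, i) (∑ x : V × Fin m with H.connectedComponentMk x.1 = c, t x) := by
      refine Eq.trans (Finset.sum_congr rfl fun x hx => ?_)
        (map_sum (AddMonoidHom.single (fun _ : V × Fin m => A) (ρ c, i)) t _).symm
      rw [← (Finset.mem_filter.1 hx).2]
      rfl
    have hsplit : ∀ b, ∑ x : V × Fin m with (H.connectedComponentMk x.1, ε x.1) = (c, b), w x =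
        ∑ x ∈ Finset.univ.filter (fun x : V × Fin m => H.connectedComponentMk x.1 = c) with
          ε x.1 = b, w x := fun b => by
      rw [Finset.filter_filter]
      simp only [Prod.mk.injEq]
    have hfalse : ∀ x : V × Fin m, (ε x.1 = false) = ¬ (ε x.1 = true) := by simp
    have ht : ∑ x : V × Fin m with H.connectedComponentMk x.1 = c, t x =
        ∑ x : V × Fin m with (H.connectedComponentMk x.1, ε x.1) = (c, false), w x -
        ∑ x : V × Fin m with (H.connectedComponentMk x.1, ε x.1) = (c, true), w x := by
      rw [hsplit, hsplit, Finset.sum_ite, Finset.sum_neg_distrib]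
      simp only [hfalse]
      abel
    rw [hτ]
    rcases hw c with ⟨⟨p, hp⟩, d, hd⟩ | h
    · have htot : ∑ x : V × Fin m with H.connectedComponentMk x.1 = c, w x =
          ∑ x : V × Fin m with (H.connectedComponentMk x.1, ε x.1) = (c, true), w x +
          ∑ x : V × Fin m with (H.connectedComponentMk x.1, ε x.1) = (c, false), w x := by
        rw [hsplit, hsplit]
        simp only [hfalse]
        rw [Finset.sum_filter_add_sum_filter_not]
      set S := ∑ x : V × Fin m with (H.connectedComponentMk x.1, ε x.1) = (c, true), w x
      have : ∑ x : V × Fin m with H.connectedComponentMk x.1 = c, t x = (d - S) + (d - S) := by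
        rw [ht, eq_sub_of_add_eq' (htot.symm.trans hd)]
        abel
      rw [this]
      -- For a closed walk of odd length the difference becomes a sum: d - S is placed twice at the
      -- root.
      have hmem := single_sub_single_mem_range H hiso p i i (d - S)
      rwa [hp.neg_one_pow, neg_one_smul, sub_neg_eq_add, ← Pi.single_add] at hmem
    · rw [ht, h, sub_self, Pi.single_zero]
      exact zero_mem _
  have h4 : ∑ x, τ x ∈ I := by
    rw [← Finset.sum_fiberwise Finset.univ (fun x : V × Fin m => H.connectedComponentMk x.1)]
    exact sum_mem fun c _ => h3 c
  simpa using add_mem h2 h4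

end Realize

end SimpleGraph

/-! ### Irregular labelings of the product and the parity obstruction. -/

namespace SimpleGraph

theorem exists_irregularLabeling_lexProduct {V A : Type*} [Fintype V] [Nonempty V]
    [AddCommGroup A] [Fintype A] (H : SimpleGraph V) (hiso : ∀ v : V, ∃ w : V, H.Adj v w)
    (heven : H.BipartiteComponentsEven) {m : ℕ} (hm : Odd m) (hm5 : 5 ≤ m)
    (hA : (Odd (Fintype.card A) ∧ m * Fintype.card V ≤ Fintype.card A) ∨
      (4 ∣ Fintype.card V ∧ Fintype.card A = m * Fintype.card V)) :
    ∃ f : (H.lexProduct (⊥ : SimpleGraph (Fin m))).edgeSet → A,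
      (H.lexProduct (⊥ : SimpleGraph (Fin m))).IsIrregularLabeling f := by
  classical
  obtain ⟨ρ, ε, hρ, hε, hbip⟩ := H.exists_walk_parity hiso heven
  let NB : H.ConnectedComponent → Prop := fun c => ∃ p : H.Walk (ρ c) (ρ c), Odd p.length
  -- A non-bipartite component is one part, indexed by `false`; its `true` part stays empty.
  let part : V → H.ConnectedComponent × Bool := fun v =>
    (H.connectedComponentMk v, if NB (H.connectedComponentMk v) then false else ε v)
  let k : H.ConnectedComponent × Bool → ℕ := fun p =>
    (Finset.univ.filter fun v => part v = p).card
  have hpart : ∀ c, ¬ NB c → ∀ b v,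
      part v = (c, b) ↔ (H.connectedComponentMk v, ε v) = (c, b) := by
    intro c hc b v
    simp only [part, Prod.mk.injEq]
    refine and_congr_right fun h => ?_
    rw [h, if_neg hc]
  have hpartNB : ∀ c, NB c → ∀ v, part v = (c, false) ↔ H.connectedComponentMk v = c := by
    intro c hc v
    simp only [part, Prod.mk.injEq, and_iff_left_iff_imp]
    intro h
    rw [h, if_pos hc]
  have hstrict : ∀ c, ¬ NB c → ∀ b, Even (k (c, b)) ∧ 0 < k (c, b) := by
    intro c hc b
    have := hbip c hc b
    simpa only [k, hpart c hc] using this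
  have hloose : ∀ c, NB c → 2 ≤ k (c, false) ∧ k (c, true) = 0 := by
    intro c hc
    constructor
    · obtain ⟨u, hu⟩ := hiso (ρ c)
      refine Finset.one_lt_card.2 ⟨ρ c, ?_, u, ?_, hu.ne⟩
      · simp [hpartNB c hc, hρ]
      · simpa [hpartNB c hc] using (ConnectedComponent.sound hu.symm.reachable).trans (hρ c)
    · rw [Finset.card_eq_zero, Finset.filter_eq_empty_iff]
      intro v _ h
      simp only [part, Prod.mk.injEq] at h
      rw [h.1, if_pos hc] at h
      simp at h
  have hk : ∑ p, k p = Fintype.card V := by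
    rw [← Finset.card_univ,
      Finset.card_eq_sum_card_fiberwise (f := part) (t := Finset.univ) (by simp)]
  have hne : Nonempty H.ConnectedComponent := ⟨H.connectedComponentMk (Classical.arbitrary V)⟩
  obtain ⟨R, σ, hall, hσ, hσNB⟩ : ∃ (R : Finset A) (σ : H.ConnectedComponent × Bool → A),
      IsAllocation R (fun p => m * k p) σ ∧ (∀ i, ¬ NB i → σ (i, true) = σ (i, false)) ∧
      ∀ i, NB i → ∀ b, ∃ d, σ (i, b) = d + d := by
    rcases hA with ⟨hodd, hle⟩ | ⟨h4, heq⟩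
    · obtain ⟨R, σ, h1, h2, h3⟩ := exists_allocation_of_odd (m := m) hodd k NB
        (fun i hi b => (hstrict i hi b).1) (by rwa [hk]) hne
      exact ⟨R, σ, h1, fun i hi => by rw [h2 i hi, h2 i hi], fun i _ b => h3 _⟩
    · obtain ⟨σ, h⟩ := exists_allocation_of_four_dvd hm hm5 h4 heq k NB hstrict hloose hk hne
      exact ⟨_, σ, h⟩
  obtain ⟨w, hinj, hw⟩ := hall.exists_labeling (fun x : V × Fin m => part x.1) (fun p => by
    have : (Finset.univ.filter fun x : V × Fin m => part x.1 = p) =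
        (Finset.univ.filter fun v => part v = p) ×ˢ Finset.univ := by
      ext x; simp
    rw [this, Finset.card_product, Finset.card_univ, Fintype.card_fin, mul_comm])
  obtain ⟨f, hf⟩ := H.mem_range_weightedDegreeHom hiso (by omega : 0 < m) hε w (fun c => by
    by_cases hc : NB c
    · obtain ⟨d, hd⟩ := hσNB c hc false
      refine Or.inl ⟨hc, d, ?_⟩
      rw [← hd, ← hw]
      simp only [hpartNB c hc]
    · right
      have h1 := hw (c, true)
      have h2 := hw (c, false)
      simp only [hpart c hc] at h1 h2
      rw [h1, h2, hσ c hc])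
  refine ⟨f, ?_⟩
  have : (H.lexProduct (⊥ : SimpleGraph (Fin m))).weightedDegree f = w := hf
  unfold IsIrregularLabeling
  rwa [this]

theorem Iso.exists_irregularLabeling {V W A : Type*} [Fintype V] [Fintype W] [AddCommGroup A]
    {G : SimpleGraph V} {L : SimpleGraph W} (φ : G ≃g L)
    (h : ∃ f : L.edgeSet → A, L.IsIrregularLabeling f) :
    ∃ f : G.edgeSet → A, G.IsIrregularLabeling f := by
  classical
  obtain ⟨f, hf⟩ := h
  have key : ∀ v, G.weightedDegree (fun e => f (φ.mapEdgeSet e)) v = L.weightedDegree f (φ v) := by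
    intro v
    unfold weightedDegree
    exact Fintype.sum_equiv (φ.mapNeighborSet v) _ _ fun u => rfl
  refine ⟨fun e => f (φ.mapEdgeSet e), fun x y hxy => φ.injective (hf ?_)⟩
  rw [← key, ← key, hxy]

theorem card_le_of_irregularLabeling {W A : Type*} [Fintype W] [AddCommGroup A] [Finite A]
    {G : SimpleGraph W} {f : G.edgeSet → A} (hf : G.IsIrregularLabeling f) :
    Fintype.card W ≤ Nat.card A := by
  rw [← Nat.card_eq_fintype_card]
  exact Nat.card_le_card_of_injective _ hf

/-- In a cyclic group of order `2` modulo `4`, the sum of all elements is not a double. -/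
theorem sum_zmod_ne_double {N : ℕ} [NeZero N] (hN : N % 4 = 2) (d : ZMod N) :
    ∑ x : ZMod N, x ≠ d + d := by
  intro h
  have hdvd : 2 ∣ N := by omega
  have hcast := congrArg (ZMod.castHom hdvd (ZMod 2)) h
  rw [map_add, CharTwo.add_self_eq_zero, map_sum] at hcast
  have hval : ∀ x : ZMod N, ZMod.castHom hdvd (ZMod 2) x = ((x.val : ℕ) : ZMod 2) := fun x => by
    conv_lhs => rw [← ZMod.natCast_zmod_val x]
    exact map_natCast _ _
  have hsum : ∑ x : ZMod N, x.val = ∑ i ∈ Finset.range N, i := by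
    refine Finset.sum_bij (fun x _ => x.val) ?_ ?_ ?_ ?_
    · exact fun x _ => Finset.mem_range.2 (ZMod.val_lt x)
    · exact fun x _ y _ hxy => ZMod.val_injective N hxy
    · exact fun i hi => ⟨(i : ZMod N), Finset.mem_univ _,
        ZMod.val_cast_of_lt (Finset.mem_range.1 hi)⟩
    · exact fun x _ => rfl
  simp only [hval] at hcast
  rw [← Nat.cast_sum, hsum, ZMod.natCast_eq_zero_iff] at hcast
  obtain ⟨e, he⟩ := hcast
  have h2 := Finset.sum_range_id_mul_two N
  -- N(N - 1)/2 = (2q + 1)(4q + 1) is odd, so the sum of all residues is nonzero modulo 2.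
  obtain ⟨q, hq⟩ : ∃ q, N = 4 * q + 2 := ⟨N / 4, by omega⟩
  rw [he, hq, show 4 * q + 2 - 1 = 4 * q + 1 by omega] at h2
  ring_nf at h2
  have h3 : 2 * e = 1 + q * 6 + q ^ 2 * 8 := by omega
  omega

/-- With as many vertices as group elements, an irregular labeling attains every element once, so
the sum of the group would be a double. -/
theorem not_irregularLabeling_zmod {W : Type*} [Fintype W] {G : SimpleGraph W} {N : ℕ} [NeZero N]
    (hN : N % 4 = 2) (hW : Fintype.card W = N) (f : G.edgeSet → ZMod N) :
    ¬ G.IsIrregularLabeling f := by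
  intro hf
  have hbij : Function.Bijective (G.weightedDegree f) :=
    (Fintype.bijective_iff_injective_and_card _).2 ⟨hf, by rw [hW, ZMod.card]⟩
  obtain ⟨d, hd⟩ := G.exists_sum_weightedDegree_eq_double f
  refine sum_zmod_ne_double hN d ?_
  rw [← hd, hbij.sum_comp (fun x => x)]

end SimpleGraph

/-! ### The strength in the two residue cases. -/

theorem mainTheorem7 {V W : Type*} [Fintype V] [Nonempty V] [Fintype W]
    (H : SimpleGraph V) (G : SimpleGraph W) (n r : ℕ)
    (hn : Fintype.card V = n)
    (hiso : ∀ v : V, ∃ w : V, H.Adj v w)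
    (heven : H.BipartiteComponentsEven)
    (hr : 2 ≤ r)
    (hG : Nonempty (G ≃g H.lexProduct (⊥ : SimpleGraph (Fin (2 * r + 1))))) :
    (¬ n ≡ 2 [MOD 4] → G.IsGroupIrregularityStrength ((2 * r + 1) * n)) ∧
    (n ≡ 2 [MOD 4] → G.IsGroupIrregularityStrength ((2 * r + 1) * n + 1)) := by
  obtain ⟨φ⟩ := hG
  have hm : Odd (2 * r + 1) := odd_two_mul_add_one r
  have hpos : 0 < n := hn ▸ Fintype.card_pos
  have hNpos : 0 < (2 * r + 1) * n := by positivity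
  have hW : Fintype.card W = (2 * r + 1) * n := by
    rw [Fintype.card_congr φ.toEquiv, Fintype.card_prod, Fintype.card_fin, hn, mul_comm]
  have hlower : ∀ t, 0 < t → (∀ (A : Type) [AddCommGroup A], Nat.card A = t →
      ∃ f : G.edgeSet → A, G.IsIrregularLabeling f) → (2 * r + 1) * n ≤ t := by
    intro t ht h
    have : NeZero t := ⟨ht.ne'⟩
    obtain ⟨f, hf⟩ := h (ZMod t) (Nat.card_zmod t)
    have := SimpleGraph.card_le_of_irregularLabeling hf
    rwa [hW, Nat.card_zmod] at this
  have hupper : ∀ (A : Type) [AddCommGroup A] [Fintype A],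
      (Odd (Fintype.card A) ∧ (2 * r + 1) * n ≤ Fintype.card A) ∨
        (4 ∣ n ∧ Fintype.card A = (2 * r + 1) * n) →
      ∃ f : G.edgeSet → A, G.IsIrregularLabeling f := by
    intro A _ _ hA
    subst hn
    exact φ.exists_irregularLabeling
      (H.exists_irregularLabeling_lexProduct hiso heven hm (by omega) hA)
  have hfin : ∀ (A : Type) (t : ℕ), 0 < t → Nat.card A = t → Nonempty (Fintype A) := by
    intro A t ht h
    have := Nat.finite_of_card_ne_zero (α := A) (by omega)
    exact ⟨Fintype.ofFinite A⟩
  constructor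
  · intro hmod
    refine ⟨⟨hNpos, fun A _ hA => ?_⟩, fun t ht => hlower t ht.1 ht.2⟩
    obtain ⟨_⟩ := hfin A _ hNpos hA
    rw [Nat.card_eq_fintype_card] at hA
    refine hupper A ?_
    -- An even n that is not 2 modulo 4 is divisible by 4; an odd n makes the group order odd.
    rcases Nat.even_or_odd n with h | h
    · refine Or.inr ⟨?_, hA⟩
      obtain ⟨d, hd⟩ := h
      unfold Nat.ModEq at hmod
      omega
    · exact Or.inl ⟨hA ▸ hm.mul h, hA.ge⟩
  · intro hmod
    have hn2 : n % 4 = 2 := hmod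
    refine ⟨⟨Nat.succ_pos _, fun A _ hA => ?_⟩, fun t ht => ?_⟩
    · obtain ⟨_⟩ := hfin A _ (Nat.succ_pos _) hA
      rw [Nat.card_eq_fintype_card] at hA
      refine hupper A (Or.inl ⟨?_, by omega⟩)
      rw [hA]
      exact ((Nat.even_iff.2 (by omega : n % 2 = 0)).mul_left _).add_one
    · refine Nat.lt_of_le_of_ne (hlower t ht.1 ht.2) fun heq => ?_
      have : NeZero t := ⟨ht.1.ne'⟩
      obtain ⟨f, hf⟩ := ht.2 (ZMod t) (Nat.card_zmod t)
      refine SimpleGraph.not_irregularLabeling_zmod ?_ (hW.trans heq) f hf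
      rw [← heq]
      obtain ⟨q, hq⟩ : ∃ q, n = 4 * q + 2 := ⟨n / 4, by omega⟩
      rw [hq]
      have : (2 * r + 1) * (4 * q + 2) = 4 * (2 * r * q + r + q) + 2 := by ring
      omega
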